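/- Let $\mathcal C$ be a semi-abelian category (pointed, Barr-exact, Bourn-protomodular, with binary coproducts). For objects $B, X$ let $B\flat X$ be the kernel of $[1,0]\colon B+X\to B$; the functor $B\flat(-)$ carries a monad structure, whose algebras are the internal actions of $B$. An internal pre-crossed module over $B$ is an arrow $\delta\colon X\to B$ with an internal action $\xi\colon B\flat X\to X$ such that $\delta\,\xi=\chi\,(1\flat\delta)$, where $\chi\colon B\flat B\to B$ is the conjugation action (the restriction of $[1,1]\colon B+B\to B$). Let $\mathbf{PXMod}_B(\mathcal C)$ be the category of pre-crossed modules over $B$, whose morphisms are the arrows of $\mathcal C$ that commute with the arrows to $B$ and with the actions. For every object $B$ of $\mathcal C$ the category $\mathbf{PXMod}_B(\mathcal C)$ has binary coproducts, denoted $X\oplus Y$, and any two subobjects of an object of $\mathbf{PXMod}_B(\mathcal C)$ have a join there. Moreover, the following two conditions on $\mathcal C$ are equivalent: (CS) for every object $B$ of $\mathcal C$ and all $(\delta_X\colon X\to B)$ and $(\delta_Y\colon Y\to B)$ in $\mathbf{PXMod}_B(\mathcal C)$, the comparison arrow $\sigma\colon X+Y\to X\oplus Y$, from the coproduct in $\mathcal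 C$ to the underlying object of the coproduct in $\mathbf{PXMod}_B(\mathcal C)$, is a regular epimorphism in $\mathcal C$; (J) for every object $B$ of $\mathcal C$, every $(\delta\colon A\to B)$ in $\mathbf{PXMod}_B(\mathcal C)$ and every pair of subobjects $X, Y$ of $A$ in $\mathbf{PXMod}_B(\mathcal C)$, the underlying subobject of their join in $\mathbf{PXMod}_B(\mathcal C)$ is the join in $\mathcal C$ of the underlying subobjects of $A$. -/

import Mathlib

open CategoryTheory Limits

universe v u

namespace SemiAb

/-- `(r₁, r₂) : R ⇉ X` is an internal equivalence relation on `X`. -/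
structure IsEquivalenceRelation {C : Type u} [Category.{v} C] [HasPullbacks C] {R X : C}
    (r₁ r₂ : R ⟶ X) : Prop where
  jointly_mono : ∀ {Z : C} (a b : Z ⟶ R), a ≫ r₁ = b ≫ r₁ → a ≫ r₂ = b ≫ r₂ → a = b
  refl : ∃ d : X ⟶ R, d ≫ r₁ = 𝟙 X ∧ d ≫ r₂ = 𝟙 X
  symm : ∃ s : R ⟶ R, s ≫ r₁ = r₂ ∧ s ≫ r₂ = r₁
  trans : ∃ t : pullback r₂ r₁ ⟶ R,
    t ≫ r₁ = pullback.fst r₂ r₁ ≫ r₁ ∧ t ≫ r₂ = pullback.snd r₂ r₁ ≫ r₂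

/-- A Barr-exact category: a regular category in which every internal equivalence relation is
effective, that is, the kernel pair of some morphism. -/
class BarrExact (C : Type u) [Category.{v} C] : Prop extends Regular C where
  effective : ∀ {R X : C} (r₁ r₂ : R ⟶ X), IsEquivalenceRelation r₁ r₂ →
    ∃ (Y : C) (f : X ⟶ Y), IsKernelPair f r₁ r₂

/-- Bourn protomodularity. A point over `B` is a split epimorphism `p : E ⟶ B` with a chosen
section `s`; a morphism of points over `B` is a morphism `h` commuting with the projections and
the sections.  The condition says that, for each `v : A ⟶ B`, the change-of-base functor along `v`
from points over `B` to points over `A` reflects isomorphisms. -/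
class Protomodular (C : Type u) [Category.{v} C] [HasPullbacks C] : Prop where
  isIso_of_changeOfBase : ∀ {A B E E' : C} (v : A ⟶ B)
    (p : E ⟶ B) (s : B ⟶ E) (p' : E' ⟶ B) (s' : B ⟶ E') (h : E ⟶ E'),
    s ≫ p = 𝟙 B → s' ≫ p' = 𝟙 B → ∀ (hp : h ≫ p' = p), s ≫ h = s' →
    IsIso (pullback.map p v p' v h (𝟙 A) (𝟙 B) (by simp [hp]) (by simp)) → IsIso h

/-- A semi-abelian category: pointed, Barr-exact, protomodular, with binary coproducts.
(The zero morphisms are a parameter; they are determined by the zero object.) -/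
class SemiAbelian (C : Type u) [Category.{v} C] [HasZeroMorphisms C] : Prop extends
  HasZeroObject C, HasBinaryCoproducts C, BarrExact C, Protomodular C

section Flat

variable {C : Type u} [Category.{v} C] [HasZeroMorphisms C] [HasBinaryCoproducts C]
  [HasFiniteLimits C]

/-- The object `B ♭ X`: the kernel of `[1, 0] : B + X ⟶ B`. -/
noncomputable def flat (B X : C) : C :=
  kernel (coprod.desc (𝟙 B) (0 : X ⟶ B))

/-- The kernel inclusion `B ♭ X ⟶ B + X`. -/
noncomputable def flatι (B X : C) : flat B X ⟶ B ⨿ X :=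
  kernel.ι (coprod.desc (𝟙 B) (0 : X ⟶ B))

instance (B X : C) : Mono (flatι B X) :=
  inferInstanceAs (Mono (equalizer.ι (coprod.desc (𝟙 B) (0 : X ⟶ B)) 0))

lemma flatι_desc (B X : C) : flatι B X ≫ coprod.desc (𝟙 B) (0 : X ⟶ B) = 0 :=
  kernel.condition _

/-- Morphisms into `B ♭ X` are the morphisms into `B + X` killed by `[1, 0]`. -/
noncomputable def flatLift {B X Z : C} (k : Z ⟶ B ⨿ X)
    (hk : k ≫ coprod.desc (𝟙 B) (0 : X ⟶ B) = 0) : Z ⟶ flat B X :=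
  kernel.lift _ k hk

@[simp]
lemma flatLift_ι {B X Z : C} (k : Z ⟶ B ⨿ X)
    (hk : k ≫ coprod.desc (𝟙 B) (0 : X ⟶ B) = 0) : flatLift k hk ≫ flatι B X = k :=
  kernel.lift_ι _ _ _

/-- `1 ♭ f : B ♭ X ⟶ B ♭ Y`, the restriction of `1 + f`. -/
noncomputable def flatMap (B : C) {X Y : C} (f : X ⟶ Y) : flat B X ⟶ flat B Y :=
  flatLift (flatι B X ≫ coprod.map (𝟙 B) f) (by
    rw [Category.assoc, coprod.map_desc, Category.id_comp, comp_zero, flatι_desc])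

/-- The unit `X ⟶ B ♭ X` of the monad `B ♭ -`, the restriction of the injection `X ⟶ B + X`. -/
noncomputable def flatUnit (B X : C) : X ⟶ flat B X :=
  flatLift coprod.inr (coprod.inr_desc _ _)

/-- The multiplication `B ♭ (B ♭ X) ⟶ B ♭ X` of the monad `B ♭ -`, the restriction of
`[inl, ι] : B + (B ♭ X) ⟶ B + X`. -/
noncomputable def flatMult (B X : C) : flat B (flat B X) ⟶ flat B X :=
  flatLift (flatι B (flat B X) ≫ coprod.desc coprod.inl (flatι B X)) (by
    rw [Category.assoc, coprod.desc_comp, coprod.inl_desc, flatι_desc, flatι_desc])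

/-- The conjugation action `χ : B ♭ B ⟶ B`, the restriction of the codiagonal `[1, 1]`. -/
noncomputable def conj (B : C) : flat B B ⟶ B :=
  flatι B B ≫ coprod.desc (𝟙 B) (𝟙 B)

/-- An internal pre-crossed module over `B`: an arrow `δ : X ⟶ B` with an internal action `ξ` of
`B` on `X` (an algebra structure for the monad `B ♭ -`), such that `δ` is equivariant with respect
to `ξ` and the conjugation action of `B` on itself. -/
structure PXMod (B : C) where
  obj : C
  δ : obj ⟶ B
  ξ : flat B obj ⟶ obj
  unit_act : flatUnit B obj ≫ ξ = 𝟙 obj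
  mult_act : flatMult B obj ≫ ξ = flatMap B ξ ≫ ξ
  precrossed : ξ ≫ δ = flatMap B δ ≫ conj B

namespace PXMod

/-- Morphisms of pre-crossed `B`-modules: equivariant morphisms over `B`. -/
@[ext]
structure Hom {B : C} (X Y : PXMod B) where
  hom : X.obj ⟶ Y.obj
  comm : hom ≫ Y.δ = X.δ
  equivariant : X.ξ ≫ hom = flatMap B hom ≫ Y.ξ

end PXMod

lemma flatMap_ι (B : C) {X Y : C} (f : X ⟶ Y) :
    flatMap B f ≫ flatι B Y = flatι B X ≫ coprod.map (𝟙 B) f :=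
  flatLift_ι _ _

lemma flatMap_id (B X : C) : flatMap B (𝟙 X) = 𝟙 (flat B X) := by
  rw [← cancel_mono (flatι B X), flatMap_ι, coprod.map_id_id, Category.comp_id, Category.id_comp]

lemma flatMap_comp (B : C) {X Y Z : C} (f : X ⟶ Y) (g : Y ⟶ Z) :
    flatMap B (f ≫ g) = flatMap B f ≫ flatMap B g := by
  rw [← cancel_mono (flatι B Z), flatMap_ι, Category.assoc, flatMap_ι, ← Category.assoc,
    flatMap_ι, Category.assoc, coprod.map_map, Category.id_comp]

lemma flatUnit_ι (B X : C) : flatUnit B X ≫ flatι B X = coprod.inr :=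
  flatLift_ι _ _

lemma flatMult_ι (B X : C) : flatMult B X ≫ flatι B X =
    flatι B (flat B X) ≫ coprod.desc coprod.inl (flatι B X) :=
  flatLift_ι _ _

lemma flatUnit_naturality (B : C) {X Y : C} (f : X ⟶ Y) :
    flatUnit B X ≫ flatMap B f = f ≫ flatUnit B Y := by
  rw [← cancel_mono (flatι B Y), Category.assoc, flatMap_ι, ← Category.assoc, flatUnit_ι,
    Category.assoc, flatUnit_ι, coprod.inr_map]

lemma flatMult_naturality (B : C) {X Y : C} (f : X ⟶ Y) :
    flatMult B X ≫ flatMap B f = flatMap B (flatMap B f) ≫ flatMult B Y := by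
  rw [← cancel_mono (flatι B Y), Category.assoc, flatMap_ι, ← Category.assoc, flatMult_ι,
    Category.assoc, Category.assoc, flatMult_ι, ← Category.assoc (flatMap B (flatMap B f)), flatMap_ι,
    Category.assoc, coprod.desc_comp, coprod.map_desc, flatMap_ι, coprod.inl_map]

namespace PXMod

noncomputable instance (B : C) : Category (PXMod B) where
  Hom X Y := Hom X Y
  id X := ⟨𝟙 X.obj, Category.id_comp _, by
    rw [flatMap_id, Category.comp_id, Category.id_comp]⟩
  comp f g := ⟨f.hom ≫ g.hom, by rw [Category.assoc, g.comm, f.comm], by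
    rw [← Category.assoc, f.equivariant, Category.assoc, g.equivariant, ← Category.assoc,
      flatMap_comp]⟩
  id_comp f := Hom.ext (Category.id_comp _)
  comp_id f := Hom.ext (Category.comp_id _)
  assoc f g h := Hom.ext (Category.assoc _ _ _)

@[ext]
lemma hom_ext {B : C} {X Y : PXMod B} {f g : X ⟶ Y} (h : f.hom = g.hom) : f = g :=
  Hom.ext h

@[simp]
lemma id_hom {B : C} (X : PXMod B) : Hom.hom (𝟙 X) = 𝟙 X.obj := rfl

@[simp]
lemma comp_hom {B : C} {X Y Z : PXMod B} (f : X ⟶ Y) (g : Y ⟶ Z) :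
    (f ≫ g).hom = f.hom ≫ g.hom := rfl

/-- The kernel pair of a morphism of pre-crossed modules, carried by the kernel pair in `C`. -/
noncomputable def kernelPair {B : C} {X Y : PXMod B} (m : X ⟶ Y) : PXMod B where
  obj := pullback m.hom m.hom
  δ := pullback.fst m.hom m.hom ≫ X.δ
  ξ := pullback.lift (flatMap B (pullback.fst m.hom m.hom) ≫ X.ξ)
    (flatMap B (pullback.snd m.hom m.hom) ≫ X.ξ) (by
      rw [Category.assoc, m.equivariant, Category.assoc, m.equivariant, ← Category.assoc,
        ← flatMap_comp, pullback.condition, flatMap_comp, Category.assoc])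
  unit_act := by
    apply pullback.hom_ext
    · rw [Category.assoc, pullback.lift_fst, ← Category.assoc, flatUnit_naturality,
        Category.assoc, X.unit_act, Category.comp_id, Category.id_comp]
    · rw [Category.assoc, pullback.lift_snd, ← Category.assoc, flatUnit_naturality,
        Category.assoc, X.unit_act, Category.comp_id, Category.id_comp]
  mult_act := by
    apply pullback.hom_ext
    · rw [Category.assoc, pullback.lift_fst, ← Category.assoc, flatMult_naturality,
        Category.assoc, X.mult_act, Category.assoc, pullback.lift_fst, ← Category.assoc,
        ← Category.assoc, ← flatMap_comp, ← flatMap_comp, pullback.lift_fst]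
    · rw [Category.assoc, pullback.lift_snd, ← Category.assoc, flatMult_naturality,
        Category.assoc, X.mult_act, Category.assoc, pullback.lift_snd, ← Category.assoc,
        ← Category.assoc, ← flatMap_comp, ← flatMap_comp, pullback.lift_snd]
  precrossed := by
    rw [← Category.assoc, pullback.lift_fst, Category.assoc, X.precrossed, flatMap_comp,
      Category.assoc]

/-- The forgetful functor to `C` preserves monomorphisms. -/
instance mono_hom {B : C} {X Y : PXMod B} (m : X ⟶ Y) [Mono m] : Mono m.hom := by
  let p₁ : kernelPair m ⟶ X := ⟨pullback.fst m.hom m.hom, rfl, pullback.lift_fst _ _ _⟩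
  have hδ : pullback.snd m.hom m.hom ≫ X.δ = pullback.fst m.hom m.hom ≫ X.δ := by
    rw [← m.comm, ← Category.assoc, ← pullback.condition, Category.assoc]
  let p₂ : kernelPair m ⟶ X := ⟨pullback.snd m.hom m.hom, hδ, pullback.lift_snd _ _ _⟩
  have h : p₁ = p₂ := (cancel_mono m).1 (hom_ext pullback.condition)
  have h' : pullback.fst m.hom m.hom = pullback.snd m.hom m.hom := congrArg Hom.hom h
  constructor
  intro Z a b hab
  have e := congrArg (fun t => pullback.lift a b hab ≫ t) h'
  exact (pullback.lift_fst a b hab).symm.trans (e.trans (pullback.lift_snd a b hab))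

/-- The subobject of the underlying object of `A` in `C` carried by a subobject of `A`. -/
noncomputable def underlyingSubobject {B : C} {A : PXMod B} (S : Subobject A) :
    Subobject A.obj :=
  Subobject.mk S.arrow.hom

/-- For a cocone `X ⟶ P ⟵ Y` of pre-crossed modules, the induced arrow `X + Y ⟶ P` in `C`
from the coproduct of the underlying objects. If `P` is the coproduct of `X` and `Y` among the
pre-crossed modules, this is the comparison arrow `σ`. -/
noncomputable def comparison {B : C} {X Y : PXMod B} (c : BinaryCofan X Y) :
    X.obj ⨿ Y.obj ⟶ PXMod.obj c.pt :=
  coprod.desc (Hom.hom c.inl) (Hom.hom c.inr)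

end PXMod

variable (C)

/-- Condition (CS): for all pre-crossed modules `X` and `Y` over the same object `B`, the
comparison arrow from the coproduct of `X` and `Y` in `C` to the coproduct of `X` and `Y` in the
category of pre-crossed `B`-modules is a regular epimorphism in `C`. -/
def ConditionCS : Prop :=
  ∀ (B : C) (X Y : PXMod B) (c : BinaryCofan X Y), Nonempty (IsColimit c) →
    IsRegularEpi (PXMod.comparison c)

/-- The join of any two subobjects of a pre-crossed `B`-module coincides with the join in `C` of
the underlying subobjects. -/
def JoinsCoincide : Prop :=
  ∀ (B : C) (A : PXMod B) (S T J : Subobject A), IsLUB {S, T} J →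
    IsLUB {PXMod.underlyingSubobject S, PXMod.underlyingSubobject T}
      (PXMod.underlyingSubobject J)

end Flat

end SemiAb

/-! Joins of pre-crossed modules are images of coproducts, and images are computed in the base
category: `B ♭ -` preserves regular epimorphisms, so the action passes to the image in `C`
(`exists_image`). Given (CS), composing `σ : S + T ⟶ S ⊕ T` with the image projection onto the join
gives a strong epimorphism from `S + T`, so the join is also the join in `C`. Conversely, the images
of the two injections of `X ⊕ Y` have join `⊤`. Under (J) this also holds in `C`. The image of `σ`
contains both, so it is everything and `σ` is a regular epimorphism.

Coproducts exist as for algebras over a monad: take the free pre-crossed module on `X + Y` and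
coequalize a reflexive pair that forces the injections to be equivariant (`exists_isCoproduct`). The
coequalizer can be formed in `C` because `B ♭ -` preserves reflexive coequalizers
(`IsCoequalizer.flatMap`). This uses exactness together with the Mal'tsev property, which follows
from protomodularity: a reflexive pair covers the kernel pair of its coequalizer. -/

namespace SemiAb

attribute [local simp] pullback.lift_fst pullback.lift_fst_assoc pullback.lift_snd
  pullback.lift_snd_assoc prod.lift_fst prod.lift_fst_assoc prod.lift_snd prod.lift_snd_assoc
  coprod.inl_desc coprod.inl_desc_assoc coprod.inr_desc coprod.inr_desc_assoc

/-! ### Coequalizers and regular epimorphisms. -/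

section Coequalizers

variable {C : Type u} [Category.{v} C]

/-- `q` is a coequalizer of `f` and `g`. -/
structure IsCoequalizer {R X Q : C} (f g : R ⟶ X) (q : X ⟶ Q) : Prop where
  w : f ≫ q = g ≫ q
  epi : Epi q
  exists_desc : ∀ {Z : C} (k : X ⟶ Z), f ≫ k = g ≫ k → ∃ h : Q ⟶ Z, q ≫ h = k

lemma IsCoequalizer.isRegularEpi {R X Q : C} {f g : R ⟶ X} {q : X ⟶ Q}
    (h : IsCoequalizer f g q) : IsRegularEpi q := by
  have := h.epi
  exact ⟨⟨{ W := R, left := f, right := g, w := h.w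
            isColimit := Cofork.IsColimit.mk' _ fun s =>
              ⟨(h.exists_desc s.π s.condition).choose, (h.exists_desc s.π s.condition).choose_spec,
                fun {m} hm => (cancel_epi q).1
                  (Eq.trans hm (h.exists_desc s.π s.condition).choose_spec.symm)⟩ }⟩⟩

lemma isCoequalizer_of_isRegularEpi {X Q : C} (q : X ⟶ Q) [IsRegularEpi q] :
    IsCoequalizer (IsRegularEpi.left q) (IsRegularEpi.right q) q where
  w := IsRegularEpi.w q
  epi := inferInstance
  exists_desc k hk := ⟨IsRegularEpi.desc q k hk, IsRegularEpi.fac q k hk⟩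

/-- A regular epimorphism is a coequalizer of its kernel pair. -/
lemma isCoequalizer_pullback {X Q : C} (q : X ⟶ Q) [HasPullback q q] [IsRegularEpi q] :
    IsCoequalizer (pullback.fst q q) (pullback.snd q q) q where
  w := pullback.condition
  epi := inferInstance
  exists_desc k hk := by
    refine (isCoequalizer_of_isRegularEpi q).exists_desc k ?_
    rw [← pullback.lift_fst _ _ (IsRegularEpi.w q), Category.assoc, hk, ← Category.assoc,
      pullback.lift_snd]

/-- An arrow out of `B + X` is a pair, and only its component on `X` has to descend. -/
lemma IsCoequalizer.coprodMap [HasBinaryCoproducts C] {R X Q : C} {f g : R ⟶ X} {q : X ⟶ Q}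
    (h : IsCoequalizer f g q) (B : C) :
    IsCoequalizer (coprod.map (𝟙 B) f) (coprod.map (𝟙 B) g) (coprod.map (𝟙 B) q) where
  w := by rw [coprod.map_map, coprod.map_map, h.w]
  epi := by have := h.epi; infer_instance
  exists_desc k hk := by
    have hk' : f ≫ coprod.inr ≫ k = g ≫ coprod.inr ≫ k := by
      have := congrArg (fun t => coprod.inr ≫ t) hk
      simpa using this
    obtain ⟨l, hl⟩ := h.exists_desc _ hk'
    refine ⟨coprod.desc (coprod.inl ≫ k) l, ?_⟩
    apply coprod.hom_ext <;> simp [hl]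

end Coequalizers

/-! ### Protomodular categories are Mal'tsev. -/

section Maltsev

variable {C : Type u} [Category.{v} C] [HasFiniteLimits C] [Protomodular C]

/-- In a protomodular category, a subobject of the pullback of `p` along a split epimorphism `p'`
is everything as soon as it contains the arrow `⟨1, p s'⟩` and a section of the second
projection. -/
lemma isIso_of_sections_factor {E E' B M : C} {p : E ⟶ B} {p' : E' ⟶ B} {s' : B ⟶ E'}
    (hs' : s' ≫ p' = 𝟙 B) (m : M ⟶ pullback p p') [Mono m]
    (i : E ⟶ M) (j : E' ⟶ M)
    (hi₁ : i ≫ m ≫ pullback.fst p p' = 𝟙 E) (hi₂ : i ≫ m ≫ pullback.snd p p' = p ≫ s')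
    (hj₂ : j ≫ m ≫ pullback.snd p p' = 𝟙 E') :
    IsIso m := by
  -- View `m` as a morphism of points over `E'`, with sections `j` and `j ≫ m`. Pulling back along
  -- `s'` turns the target into a copy of `E`, over which `i` gives a section of the mono `P`.
  refine Protomodular.isIso_of_changeOfBase s' (m ≫ pullback.snd p p') j
    (pullback.snd p p') (j ≫ m) m hj₂ (by rw [Category.assoc, hj₂]) rfl rfl ?_
  set P := pullback.map (m ≫ pullback.snd p p') s' (pullback.snd p p') s' m (𝟙 _) (𝟙 _)
    (by simp) (by simp) with hP
  have key : pullback.snd (pullback.snd p p') s' =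
      pullback.fst (pullback.snd p p') s' ≫ pullback.fst p p' ≫ p := by
    rw [pullback.condition, ← Category.assoc, pullback.condition, Category.assoc, hs',
      Category.comp_id]
  have : Mono P := by
    constructor
    intro Z a b hab
    apply pullback.hom_ext
    · have := congrArg (fun t => t ≫ pullback.fst _ _) hab
      rw [← cancel_mono m]
      simpa [hP, pullback.map] using this
    · have := congrArg (fun t => t ≫ pullback.snd _ _) hab
      simpa [hP, pullback.map] using this
  let r : pullback (pullback.snd p p') s' ⟶ pullback (m ≫ pullback.snd p p') s' :=
    pullback.lift (pullback.fst _ _ ≫ pullback.fst _ _ ≫ i) (pullback.snd _ _) (by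
      simp only [Category.assoc, hi₂]
      rw [key]; simp only [Category.assoc])
  have hr : r ≫ P = 𝟙 _ := by
    apply pullback.hom_ext
    · simp only [r, hP, Category.assoc, pullback.map, pullback.lift_fst, pullback.lift_fst_assoc,
        Category.id_comp]
      apply pullback.hom_ext
      · simp only [Category.assoc, hi₁, Category.comp_id]
      · simp only [Category.assoc, hi₂]
        rw [pullback.condition (f := pullback.snd p p'), key]
        simp only [Category.assoc]
    · simp [r, hP, pullback.map]
  have : IsSplitEpi P := IsSplitEpi.mk' ⟨r, hr⟩
  exact isIso_of_mono_of_isSplitEpi P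

/-- Every relation in a protomodular category is difunctional. -/
lemma exists_difunctional {R X : C} {r₁ r₂ : R ⟶ X}
    (hm : ∀ {Z : C} (a b : Z ⟶ R), a ≫ r₁ = b ≫ r₁ → a ≫ r₂ = b ≫ r₂ → a = b)
    {Z : C} (a b c : Z ⟶ R) (hab : a ≫ r₂ = b ≫ r₂) (hbc : b ≫ r₁ = c ≫ r₁) :
    ∃ d : Z ⟶ R, d ≫ r₁ = a ≫ r₁ ∧ d ≫ r₂ = c ≫ r₂ := by
  let p := pullback.snd r₂ r₂
  let s : R ⟶ pullback r₂ r₂ := pullback.lift (𝟙 R) (𝟙 R) rfl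
  let p' := pullback.fst r₁ r₁
  let s' : R ⟶ pullback r₁ r₁ := pullback.lift (𝟙 R) (𝟙 R) rfl
  have : Mono (prod.lift r₁ r₂) := ⟨fun x y hxy => hm x y
    (by simpa using congrArg (fun t => t ≫ prod.fst) hxy)
    (by simpa using congrArg (fun t => t ≫ prod.snd) hxy)⟩
  -- `pullback p p'` consists of the composable triples `(a, b, c)`, and `φ` sends one to `(a r₁, c
  -- r₂)`. Difunctionality says that `φ` factors through `R`. This is clear for `(a, b, b)`, where
  -- the pair is `a`, and for `(b, b, c)`, where it is `c`; these triples are `e₁` and `e₂`.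
  let φ : pullback p p' ⟶ X ⨯ X := prod.lift
    (pullback.fst p p' ≫ pullback.fst r₂ r₂ ≫ r₁) (pullback.snd p p' ≫ pullback.snd r₁ r₁ ≫ r₂)
  let e₁ : pullback r₂ r₂ ⟶ pullback p p' := pullback.lift (𝟙 _) (p ≫ s') (by simp [p', s'])
  let e₂ : pullback r₁ r₁ ⟶ pullback p p' := pullback.lift (p' ≫ s) (𝟙 _) (by simp [p, s])
  let i : pullback r₂ r₂ ⟶ pullback φ (prod.lift r₁ r₂) :=
    pullback.lift e₁ (pullback.fst r₂ r₂) (by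
      apply Limits.prod.hom_ext
      · simp [e₁, φ]
      · simp [e₁, φ, s', p, pullback.condition])
  let j : pullback r₁ r₁ ⟶ pullback φ (prod.lift r₁ r₂) :=
    pullback.lift e₂ (pullback.snd r₁ r₁) (by
      apply Limits.prod.hom_ext
      · simp [e₂, φ, s, p', pullback.condition]
      · simp [e₂, φ])
  have iso : IsIso (pullback.fst φ (prod.lift r₁ r₂)) :=
    isIso_of_sections_factor (s' := s') (by simp [p', s']) _ i j
      (by simp [i, e₁]) (by simp [i, e₁]) (by simp [j, e₂])
  let z : Z ⟶ pullback p p' := pullback.lift (pullback.lift a b hab) (pullback.lift b c hbc)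
    (by simp [p, p'])
  refine ⟨z ≫ inv (pullback.fst φ (prod.lift r₁ r₂)) ≫ pullback.snd _ _, ?_, ?_⟩
  · have : pullback.snd φ (prod.lift r₁ r₂) ≫ r₁ = pullback.fst φ (prod.lift r₁ r₂) ≫ φ ≫ prod.fst
      := by rw [pullback.condition_assoc, prod.lift_fst]
    simp [this, φ, z]
  · have : pullback.snd φ (prod.lift r₁ r₂) ≫ r₂ = pullback.fst φ (prod.lift r₁ r₂) ≫ φ ≫ prod.snd
      := by rw [pullback.condition_assoc, prod.lift_snd]
    simp [this, φ, z]

/-- Protomodular categories are Mal'tsev: reflexive relations are equivalence relations. -/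
lemma isEquivalenceRelation_of_reflexive {R X : C} {r₁ r₂ : R ⟶ X}
    (hm : ∀ {Z : C} (a b : Z ⟶ R), a ≫ r₁ = b ≫ r₁ → a ≫ r₂ = b ≫ r₂ → a = b)
    (d : X ⟶ R) (h₁ : d ≫ r₁ = 𝟙 X) (h₂ : d ≫ r₂ = 𝟙 X) : IsEquivalenceRelation r₁ r₂ where
  jointly_mono := hm
  refl := ⟨d, h₁, h₂⟩
  symm := by
    -- For `x R y`, the triple is `(y, y)`, `(x, y)`, `(x, x)`, giving `y R x`. For transitivity it
    -- is `(x, y)`, `(y, y)`, `(y, z)`.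
    obtain ⟨s, hs₁, hs₂⟩ := exists_difunctional hm (r₂ ≫ d) (𝟙 R) (r₁ ≫ d)
      (by simp [h₂]) (by simp [h₁])
    exact ⟨s, by simpa [h₁] using hs₁, by simpa [h₂] using hs₂⟩
  trans := exists_difunctional hm (pullback.fst r₂ r₁) (pullback.fst r₂ r₁ ≫ r₂ ≫ d)
      (pullback.snd r₂ r₁) (by simp [h₂]) (by simp [h₁, pullback.condition])

end Maltsev

/-! ### Reflexive coequalizers in an exact protomodular category. -/

section Exact

variable {C : Type u} [Category.{v} C]

/-- In a regular category, a morphism has a factorization into a regular epimorphism and a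
monomorphism. -/
lemma exists_regularEpi_mono [Regular C] {X Y : C} (f : X ⟶ Y) :
    ∃ (I : C) (e : X ⟶ I) (m : I ⟶ Y), IsRegularEpi e ∧ Mono m ∧ e ≫ m = f :=
  ⟨_, (Regular.strongEpiMonoFactorisation f).e, (Regular.strongEpiMonoFactorisation f).m,
    inferInstance, inferInstance, (Regular.strongEpiMonoFactorisation f).fac⟩

variable [BarrExact C] [Protomodular C]

/-- A reflexive pair has a coequalizer, and it covers the kernel pair of the coequalizer. -/
lemma exists_isCoequalizer_of_reflexive {R X : C} (f g : R ⟶ X) (d : X ⟶ R)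
    (hf : d ≫ f = 𝟙 X) (hg : d ≫ g = 𝟙 X) :
    ∃ (Q : C) (q : X ⟶ Q) (w : f ≫ q = g ≫ q), IsCoequalizer f g q ∧
      IsRegularEpi (pullback.lift f g w) := by
  -- The image `I` of `R` in `X ⨯ X` is a reflexive relation, hence an equivalence relation, hence a
  -- kernel pair.
  obtain ⟨I, e, m, he, hm, hem⟩ := exists_regularEpi_mono (prod.lift f g)
  have hef : e ≫ m ≫ prod.fst = f := by rw [← Category.assoc, hem, prod.lift_fst]
  have heg : e ≫ m ≫ prod.snd = g := by rw [← Category.assoc, hem, prod.lift_snd]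
  have hjm : ∀ {Z : C} (a b : Z ⟶ I), a ≫ m ≫ prod.fst = b ≫ m ≫ prod.fst →
      a ≫ m ≫ prod.snd = b ≫ m ≫ prod.snd → a = b := fun a b h₁ h₂ => by
    rw [← cancel_mono m]
    apply Limits.prod.hom_ext <;> simpa
  obtain ⟨Y, y, hy⟩ := BarrExact.effective _ _ (isEquivalenceRelation_of_reflexive hjm (d ≫ e)
    (by rw [Category.assoc, hef, hf]) (by rw [Category.assoc, heg, hg]))
  have := Regular.hasCoequalizer_of_isKernelPair hy
  let q := coequalizer.π (m ≫ (prod.fst : X ⨯ X ⟶ X)) (m ≫ prod.snd)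
  have hq : IsCoequalizer f g q := by
    refine ⟨?_, inferInstance, fun k hk => ?_⟩
    · rw [← hef, ← heg, Category.assoc, Category.assoc, Category.assoc, Category.assoc]
      exact congrArg (fun t => e ≫ t) (by simpa using coequalizer.condition (m ≫ prod.fst) (m ≫ prod.snd))
    · have hk' : (m ≫ prod.fst) ≫ k = (m ≫ prod.snd) ≫ k := by
        rw [← cancel_epi e, ← Category.assoc, hef, ← Category.assoc, heg, hk]
      exact ⟨coequalizer.desc k hk', coequalizer.π_desc _ _⟩
  -- Effectiveness only makes `I` the kernel pair of some `y`; since `y` factors through `q`, it is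
  -- that of `q` too.
  have hK : IsKernelPair q (m ≫ prod.fst) (m ≫ prod.snd) := by
    refine IsKernelPair.cancel_right (f₂ := coequalizer.desc y hy.w) (coequalizer.condition _ _) ?_
    rwa [coequalizer.π_desc]
  refine ⟨_, q, hq.w, hq, ?_⟩
  have : pullback.lift f g hq.w = e ≫ hK.isoPullback.hom := by
    apply pullback.hom_ext <;> simp [hef, heg]
  rw [this]
  have : ExtremalEpi (e ≫ hK.isoPullback.hom) := inferInstance
  infer_instance

/-- Two coequalizers of the same pair factor through each other, so their kernel pairs agree, and
the covering property transfers from the constructed one to any other. -/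
lemma IsCoequalizer.isRegularEpi_lift {R X Q : C} {f g : R ⟶ X} {q : X ⟶ Q}
    (h : IsCoequalizer f g q) (d : X ⟶ R) (hf : d ≫ f = 𝟙 X) (hg : d ≫ g = 𝟙 X) :
    IsRegularEpi (pullback.lift f g h.w) := by
  obtain ⟨Q', q', w, hq', hl⟩ := exists_isCoequalizer_of_reflexive f g d hf hg
  obtain ⟨t, ht⟩ := h.exists_desc q' hq'.w
  obtain ⟨t', ht'⟩ := hq'.exists_desc q h.w
  let j : pullback q' q' ⟶ pullback q q := pullback.lift (pullback.fst _ _) (pullback.snd _ _)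
    (by rw [← ht', pullback.condition_assoc])
  let j' : pullback q q ⟶ pullback q' q' := pullback.lift (pullback.fst _ _) (pullback.snd _ _)
    (by rw [← ht, pullback.condition_assoc])
  have : IsIso j := ⟨j', by apply pullback.hom_ext <;> simp [j, j'],
    by apply pullback.hom_ext <;> simp [j, j']⟩
  have e : pullback.lift f g h.w = pullback.lift f g w ≫ j := by
    apply pullback.hom_ext <;> simp [j]
  rw [e]
  have : ExtremalEpi (pullback.lift f g w ≫ j) := inferInstance
  infer_instance

end Exact

/-! ### Exactness properties of `B ♭ -`. -/

section FlatExact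

variable {C : Type u} [Category.{v} C] [HasZeroMorphisms C] [HasBinaryCoproducts C]

/-- `B ♭ X` is the pullback of `B + X ⟶ B + Y` along `B ♭ Y ⟶ B + Y`. -/
lemma isPullback_flatMap [HasFiniteLimits C] (B : C) {X Y : C} (f : X ⟶ Y) :
    IsPullback (flatι B X) (flatMap B f) (coprod.map (𝟙 B) f) (flatι B Y) where
  w := (flatMap_ι B f).symm
  isLimit' := ⟨PullbackCone.IsLimit.mk _
    (fun s => flatLift s.fst (by
      have h : coprod.desc (𝟙 B) (0 : X ⟶ B) =
          coprod.map (𝟙 B) f ≫ coprod.desc (𝟙 B) (0 : Y ⟶ B) := by simp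
      rw [h, ← Category.assoc, s.condition, Category.assoc, flatι_desc, comp_zero]))
    (fun s => flatLift_ι _ _)
    (fun s => by
      rw [← cancel_mono (flatι B Y), Category.assoc, flatMap_ι, ← Category.assoc, flatLift_ι,
        s.condition])
    (fun s m h _ => by rw [← cancel_mono (flatι B X), h, flatLift_ι])⟩

/-- `B ♭ -` preserves regular epimorphisms. -/
instance isRegularEpi_flatMap [Regular C] (B : C) {X Y : C} (f : X ⟶ Y) [IsRegularEpi f] :
    IsRegularEpi (flatMap B f) :=
  have : IsRegularEpi (coprod.map (𝟙 B) f) :=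
    ((isCoequalizer_of_isRegularEpi f).coprodMap B).isRegularEpi
  Regular.regularEpiIsStableUnderBaseChange.of_isPullback (isPullback_flatMap B f) this

/-- `B ♭ -` preserves coequalizers of reflexive pairs. -/
lemma IsCoequalizer.flatMap [BarrExact C] [Protomodular C] {R X Q : C} {f g : R ⟶ X} {q : X ⟶ Q}
    (h : IsCoequalizer f g q) (d : X ⟶ R) (hf : d ≫ f = 𝟙 X) (hg : d ≫ g = 𝟙 X) (B : C) :
    IsCoequalizer (flatMap B f) (flatMap B g) (flatMap B q) := by
  have := h.isRegularEpi
  have hB := h.coprodMap B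
  have hl := hB.isRegularEpi_lift (coprod.map (𝟙 B) d) (by rw [coprod.map_map, hf]; simp)
    (by rw [coprod.map_map, hg]; simp)
  refine ⟨by rw [← flatMap_comp, h.w, flatMap_comp], inferInstance, fun k hk => ?_⟩
  refine (isCoequalizer_pullback (SemiAb.flatMap B q)).exists_desc k ?_
  let a := pullback.fst (SemiAb.flatMap B q) (SemiAb.flatMap B q)
  let b := pullback.snd (SemiAb.flatMap B q) (SemiAb.flatMap B q)
  let c : pullback (SemiAb.flatMap B q) (SemiAb.flatMap B q) ⟶
      pullback (coprod.map (𝟙 B) q) (coprod.map (𝟙 B) q) :=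
    pullback.lift (a ≫ flatι B X) (b ≫ flatι B X) (by
      rw [Category.assoc, ← flatMap_ι, Category.assoc, ← flatMap_ι, ← Category.assoc,
        pullback.condition, Category.assoc])
  let l := pullback.lift (coprod.map (𝟙 B) f) (coprod.map (𝟙 B) g) hB.w
  have hl₁ : l ≫ pullback.fst _ _ = coprod.map (𝟙 B) f := pullback.lift_fst _ _ _
  have hl₂ : l ≫ pullback.snd _ _ = coprod.map (𝟙 B) g := pullback.lift_snd _ _ _
  have hl' : IsRegularEpi l := hl
  -- The kernel pair of `B ♭ q` maps to that of `1 + q`, which is covered by `B + R`; `π` is the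
  -- pulled-back cover.
  let π := pullback.fst c l
  have hπ : Epi π := inferInstance
  have h₁ : π ≫ a ≫ flatι B X = pullback.snd c l ≫ coprod.map (𝟙 B) f := by
    rw [← hl₁, ← pullback.condition_assoc, pullback.lift_fst]
  have h₂ : π ≫ b ≫ flatι B X = pullback.snd c l ≫ coprod.map (𝟙 B) g := by
    rw [← hl₂, ← pullback.condition_assoc, pullback.lift_snd]
  -- The covering element of `B + R` lies in `B ♭ R`: `[1, 0]` on `B + R` factors through `1 + f`,
  -- and the image under `1 + f` comes from `B ♭ X`.
  let t : pullback c l ⟶ flat B R := flatLift (pullback.snd c l) (by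
    have : coprod.desc (𝟙 B) (0 : R ⟶ B) = coprod.map (𝟙 B) f ≫ coprod.desc (𝟙 B) (0 : X ⟶ B) := by
      simp
    rw [this, ← Category.assoc, ← h₁, Category.assoc, Category.assoc, flatι_desc, comp_zero,
      comp_zero])
  have t₁ : t ≫ SemiAb.flatMap B f = π ≫ a := by
    rw [← cancel_mono (flatι B X), Category.assoc, flatMap_ι, ← Category.assoc, flatLift_ι,
      Category.assoc, h₁]
  have t₂ : t ≫ SemiAb.flatMap B g = π ≫ b := by
    rw [← cancel_mono (flatι B X), Category.assoc, flatMap_ι, ← Category.assoc, flatLift_ι,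
      Category.assoc, h₂]
  rw [← cancel_epi π, ← Category.assoc, ← t₁, Category.assoc, hk, ← Category.assoc, t₂,
    Category.assoc]

end FlatExact

namespace PXMod

variable {C : Type u} [Category.{v} C] [HasZeroMorphisms C] [HasBinaryCoproducts C]

/-! ### Free pre-crossed modules. -/

section Free

variable [HasFiniteLimits C] {B : C}

lemma flatUnit_flatMult (B X : C) : flatUnit B (flat B X) ≫ flatMult B X = 𝟙 (flat B X) := by
  rw [← cancel_mono (flatι B X), Category.assoc, flatMult_ι, ← Category.assoc, flatUnit_ι,
    coprod.inr_desc, Category.id_comp]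

lemma flatMap_flatUnit_flatMult (B X : C) :
    flatMap B (flatUnit B X) ≫ flatMult B X = 𝟙 (flat B X) := by
  rw [← cancel_mono (flatι B X), Category.assoc, flatMult_ι, ← Category.assoc, flatMap_ι,
    Category.assoc, coprod.map_desc, flatUnit_ι, Category.id_comp, coprod.desc_inl_inr,
    Category.comp_id, Category.id_comp]

lemma flatMult_flatMult (B X : C) : flatMult B (flat B X) ≫ flatMult B X =
    flatMap B (flatMult B X) ≫ flatMult B X := by
  rw [← cancel_mono (flatι B X), Category.assoc, flatMult_ι, ← Category.assoc, flatMult_ι,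
    Category.assoc, Category.assoc, flatMult_ι, ← Category.assoc (flatMap _ _), flatMap_ι, Category.assoc,
    coprod.map_desc, coprod.desc_comp, coprod.inl_desc, flatMult_ι, Category.id_comp]

lemma flatUnit_conj (B : C) : flatUnit B B ≫ conj B = 𝟙 B := by
  rw [conj, ← Category.assoc, flatUnit_ι, coprod.inr_desc]

/-- Associativity of the conjugation action; it makes the structure arrow of a free module
equivariant. -/
lemma flatMult_conj (B : C) : flatMult B B ≫ conj B = flatMap B (conj B) ≫ conj B := by
  conv_lhs => rw [conj]
  conv_rhs => arg 2; rw [conj]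
  rw [← Category.assoc, flatMult_ι, ← Category.assoc (flatMap _ _), flatMap_ι, Category.assoc,
    Category.assoc, coprod.desc_comp, coprod.map_desc, coprod.inl_desc, Category.id_comp,
    Category.comp_id, conj]

/-- The free pre-crossed module on an arrow `f : X ⟶ B`. -/
noncomputable def free {X : C} (f : X ⟶ B) : PXMod B where
  obj := flat B X
  δ := flatMap B f ≫ conj B
  ξ := flatMult B X
  unit_act := flatUnit_flatMult B X
  mult_act := flatMult_flatMult B X
  precrossed := by
    rw [← Category.assoc, flatMult_naturality, Category.assoc, flatMult_conj, flatMap_comp,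
      Category.assoc]

/-- The unit of the free pre-crossed module on an arrow over `B`. -/
noncomputable def freeUnit {X : C} (f : X ⟶ B) : X ⟶ (free f).obj :=
  flatUnit B X

lemma freeUnit_δ {X : C} (f : X ⟶ B) : freeUnit f ≫ (free f).δ = f := by
  change flatUnit B X ≫ flatMap B f ≫ conj B = f
  rw [← Category.assoc, flatUnit_naturality, Category.assoc, flatUnit_conj, Category.comp_id]

lemma exists_freeLift {X : C} {f : X ⟶ B} {A : PXMod B} (k : X ⟶ A.obj) (hk : k ≫ A.δ = f) :
    ∃ h : free f ⟶ A, freeUnit f ≫ h.hom = k := by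
  refine ⟨⟨(flatMap B k ≫ A.ξ : flat B X ⟶ A.obj), ?_, ?_⟩, ?_⟩
  · change (flatMap B k ≫ A.ξ) ≫ A.δ = flatMap B f ≫ conj B
    rw [Category.assoc, A.precrossed, ← Category.assoc, ← flatMap_comp, hk]
  · change flatMult B X ≫ flatMap B k ≫ A.ξ = flatMap B (X := flat B X) (flatMap B k ≫ A.ξ) ≫ A.ξ
    rw [← Category.assoc, flatMult_naturality, Category.assoc, A.mult_act, flatMap_comp,
      Category.assoc]
  · change flatUnit B X ≫ flatMap B k ≫ A.ξ = k
    rw [← Category.assoc, flatUnit_naturality, Category.assoc, A.unit_act, Category.comp_id]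

/-- An equivariant arrow `a` is recovered from its restriction to generators as `B ♭ (unit ≫ a)`
followed by the action. -/
lemma free_hom_ext {X : C} {f : X ⟶ B} {A : PXMod B} {a b : free f ⟶ A}
    (h : freeUnit f ≫ a.hom = freeUnit f ≫ b.hom) : a = b := by
  have key : ∀ a : flat B X ⟶ A.obj, flatMult B X ≫ a = flatMap B a ≫ A.ξ →
      a = flatMap B (flatUnit B X ≫ a) ≫ A.ξ := by
    intro a e
    rw [flatMap_comp, Category.assoc, ← e, ← Category.assoc, flatMap_flatUnit_flatMult,
      Category.id_comp]
  refine hom_ext ((key a.hom a.equivariant).trans (Eq.trans ?_ (key b.hom b.equivariant).symm))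
  exact congrArg (fun t => flatMap B t ≫ A.ξ) h

end Free

/-! ### Images of pre-crossed modules. -/

section Regular

lemma mono_of_mono_hom [HasFiniteLimits C] {B : C} {X Y : PXMod B} (m : X ⟶ Y) (h : Mono m.hom) :
    Mono m :=
  ⟨fun _ _ hab => hom_ext ((cancel_mono m.hom).1 (congrArg Hom.hom hab))⟩

/-- Images of morphisms of pre-crossed modules are computed in the base category. -/
lemma exists_image [Regular C] {B : C} {X A : PXMod B} (f : X ⟶ A) :
    ∃ (I : PXMod B) (e : X ⟶ I) (m : I ⟶ A), IsRegularEpi e.hom ∧ Mono m ∧ e ≫ m = f := by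
  obtain ⟨I, e, m, he, hm, hem⟩ := exists_regularEpi_mono f.hom
  -- The action on the image is the diagonal filler, available because `B ♭ e` is a strong
  -- epimorphism; the axioms then follow by cancelling `m`.
  have sq : CommSq (X.ξ ≫ e) (flatMap B e) m (flatMap B m ≫ A.ξ) := ⟨by
    rw [Category.assoc, hem, f.equivariant, ← hem, flatMap_comp, Category.assoc]⟩
  have : StrongEpi (flatMap B e) := inferInstance
  have h₁ : flatMap B e ≫ sq.lift = X.ξ ≫ e := sq.fac_left
  have h₂ : sq.lift ≫ m = flatMap B m ≫ A.ξ := sq.fac_right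
  let J : PXMod B :=
    { obj := I
      δ := m ≫ A.δ
      ξ := sq.lift
      unit_act := by
        rw [← cancel_mono m, Category.assoc, h₂, ← Category.assoc, flatUnit_naturality,
          Category.assoc, A.unit_act, Category.comp_id, Category.id_comp]
      mult_act := by
        rw [← cancel_mono m, Category.assoc, h₂, ← Category.assoc, flatMult_naturality,
          Category.assoc, A.mult_act, Category.assoc, h₂, ← Category.assoc, ← Category.assoc,
          ← flatMap_comp, ← flatMap_comp, h₂]
      precrossed := by
        rw [← Category.assoc, h₂, Category.assoc, A.precrossed, flatMap_comp, Category.assoc] }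
  let e' : X ⟶ J := ⟨e, by change e ≫ m ≫ A.δ = _; rw [← Category.assoc, hem, f.comm], h₁.symm⟩
  let m' : J ⟶ A := ⟨m, rfl, h₂⟩
  exact ⟨J, e', m', he, mono_of_mono_hom m' hm, hom_ext hem⟩

/-- A morphism whose underlying arrow is a regular epimorphism is left orthogonal to
monomorphisms. -/
lemma exists_lift [Regular C] {B : C} {X Y Z W : PXMod B} (e : X ⟶ Y) (he : IsRegularEpi e.hom)
    (m : Z ⟶ W) [Mono m] (a : X ⟶ Z) (b : Y ⟶ W) (h : a ≫ m = e ≫ b) :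
    ∃ l : Y ⟶ Z, l ≫ m = b := by
  have sq : CommSq a.hom e.hom m.hom b.hom := ⟨congrArg Hom.hom h⟩
  have h₂ : sq.lift ≫ m.hom = b.hom := sq.fac_right
  refine ⟨⟨sq.lift, by rw [← m.comm, ← Category.assoc, h₂, b.comm], ?_⟩, hom_ext h₂⟩
  rw [← cancel_mono m.hom, Category.assoc, h₂, b.equivariant, Category.assoc, m.equivariant,
    ← Category.assoc, ← flatMap_comp, h₂]

end Regular

/-! ### The universal property of coproducts of pre-crossed modules. -/

section IsCoproduct

variable [HasFiniteLimits C] {B : C}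

/-- The morphisms `i` and `j` exhibit their target as a coproduct of pre-crossed modules. -/
structure IsCoproduct {X Y P : PXMod B} (i : X ⟶ P) (j : Y ⟶ P) : Prop where
  exists_desc : ∀ {Z : PXMod B} (a : X ⟶ Z) (b : Y ⟶ Z), ∃ h : P ⟶ Z, i ≫ h = a ∧ j ≫ h = b
  hom_ext : ∀ {Z : PXMod B} (h h' : P ⟶ Z), i ≫ h = i ≫ h' → j ≫ h = j ≫ h' → h = h'

lemma isCoproduct_of_isColimit {X Y : PXMod B} {c : BinaryCofan X Y} (hc : IsColimit c) :
    IsCoproduct (show X ⟶ c.pt from c.inl) (show Y ⟶ c.pt from c.inr) where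
  exists_desc a b := ⟨(BinaryCofan.IsColimit.desc' hc a b).1,
    (BinaryCofan.IsColimit.desc' hc a b).2⟩
  hom_ext _ _ h₁ h₂ := BinaryCofan.IsColimit.hom_ext hc h₁ h₂

lemma IsCoproduct.nonempty_isColimit {X Y P : PXMod B} {i : X ⟶ P} {j : Y ⟶ P}
    (h : IsCoproduct i j) : Nonempty (IsColimit (BinaryCofan.mk i j)) :=
  ⟨BinaryCofan.isColimitMk
    (fun s => (h.exists_desc s.inl s.inr).choose)
    (fun s => (h.exists_desc s.inl s.inr).choose_spec.1)
    (fun s => (h.exists_desc s.inl s.inr).choose_spec.2)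
    (fun s _ h₁ h₂ => h.hom_ext _ _
      (h₁.trans (h.exists_desc s.inl s.inr).choose_spec.1.symm)
      (h₂.trans (h.exists_desc s.inl s.inr).choose_spec.2.symm))⟩

end IsCoproduct

/-! ### Existence of coproducts of pre-crossed modules. -/

section Coproduct

variable [BarrExact C] [Protomodular C] {B : C}

/-- Pre-crossed modules have coequalizers of pairs that are reflexive in the base category. -/
lemma exists_coequalizer {R A : PXMod B} (f g : R ⟶ A) (d : A.obj ⟶ R.obj)
    (hf : d ≫ f.hom = 𝟙 _) (hg : d ≫ g.hom = 𝟙 _) :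
    ∃ (Q : PXMod B) (q : A ⟶ Q), f ≫ q = g ≫ q ∧ Epi q.hom ∧
      ∀ {Z : PXMod B} (k : A ⟶ Z), f ≫ k = g ≫ k → ∃ h : Q ⟶ Z, q ≫ h = k := by
  obtain ⟨Q, q, -, hq, -⟩ := exists_isCoequalizer_of_reflexive f.hom g.hom d hf hg
  have := hq.epi
  have := hq.isRegularEpi
  -- As `B ♭ q` is again a coequalizer, the action descends to `Q`. The axioms are checked after
  -- cancelling the epimorphisms `q`, `B ♭ q` and `B ♭ (B ♭ q)`.
  have hT := hq.flatMap d hf hg B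
  obtain ⟨δ, hδ⟩ := hq.exists_desc A.δ (by rw [f.comm, g.comm])
  obtain ⟨ξ, hξ⟩ := hT.exists_desc (A.ξ ≫ q) (by
    rw [← Category.assoc, ← f.equivariant, ← Category.assoc, ← g.equivariant, Category.assoc,
      Category.assoc, hq.w])
  let Q' : PXMod B :=
    { obj := Q
      δ := δ
      ξ := ξ
      unit_act := by
        rw [← cancel_epi q, ← Category.assoc, ← flatUnit_naturality, Category.assoc, hξ,
          ← Category.assoc, A.unit_act, Category.id_comp, Category.comp_id]
      mult_act := by
        rw [← cancel_epi (flatMap B (flatMap B q)), ← Category.assoc, ← flatMult_naturality,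
          Category.assoc, hξ, ← Category.assoc, A.mult_act, ← Category.assoc, ← flatMap_comp, hξ,
          flatMap_comp, Category.assoc, Category.assoc, hξ]
      precrossed := by
        rw [← cancel_epi (flatMap B q), ← Category.assoc, hξ, Category.assoc, hδ, A.precrossed,
          ← Category.assoc, ← flatMap_comp, hδ] }
  let q' : A ⟶ Q' := ⟨q, hδ, hξ.symm⟩
  refine ⟨Q', q', hom_ext hq.w, hq.epi, fun {Z} k hk => ?_⟩
  obtain ⟨h, hh⟩ := hq.exists_desc k.hom (congrArg Hom.hom hk)
  refine ⟨⟨h, ?_, ?_⟩, hom_ext hh⟩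
  · change h ≫ Z.δ = δ
    rw [← cancel_epi q, ← Category.assoc, hh, k.comm, hδ]
  · change ξ ≫ h = flatMap B h ≫ Z.ξ
    rw [← cancel_epi (flatMap B q), ← Category.assoc, hξ, Category.assoc, hh, k.equivariant,
      ← Category.assoc, ← flatMap_comp, hh]

/-- Present the coproduct by generators `X + Y` and relations `B ♭ X + B ♭ Y`: acting inside `X` or
`Y` (`act`) must agree with acting freely (`can`). -/
lemma exists_isCoproduct (X Y : PXMod B) :
    ∃ (P : PXMod B) (i : X ⟶ P) (j : Y ⟶ P), IsCoproduct i j := by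
  let δ : X.obj ⨿ Y.obj ⟶ B := coprod.desc X.δ Y.δ
  let η := freeUnit δ
  have hη : η ≫ (free δ).δ = δ := freeUnit_δ δ
  let can : flat B X.obj ⨿ flat B Y.obj ⟶ (free δ).obj :=
    coprod.desc (flatMap B (coprod.inl ≫ η) ≫ (free δ).ξ)
      (flatMap B (coprod.inr ≫ η) ≫ (free δ).ξ)
  let act : flat B X.obj ⨿ flat B Y.obj ⟶ X.obj ⨿ Y.obj := coprod.map X.ξ Y.ξ
  -- The monad units supply the common section that makes the pair of relations reflexive.
  let u : X.obj ⨿ Y.obj ⟶ flat B X.obj ⨿ flat B Y.obj :=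
    coprod.map (flatUnit B X.obj) (flatUnit B Y.obj)
  have hact : (act ≫ η) ≫ (free δ).δ = can ≫ (free δ).δ := by
    rw [Category.assoc, hη]
    apply coprod.hom_ext
    · rw [coprod.inl_map_assoc, coprod.inl_desc, coprod.inl_desc_assoc, Category.assoc,
        (free δ).precrossed, ← Category.assoc, ← flatMap_comp, Category.assoc, hη, coprod.inl_desc,
        X.precrossed]
    · rw [coprod.inr_map_assoc, coprod.inr_desc, coprod.inr_desc_assoc, Category.assoc,
        (free δ).precrossed, ← Category.assoc, ← flatMap_comp, Category.assoc, hη, coprod.inr_desc,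
        Y.precrossed]
  have huact : u ≫ act = 𝟙 _ := by
    rw [coprod.map_map, X.unit_act, Y.unit_act, coprod.map_id_id]
  have hucan : u ≫ can = η := by
    apply coprod.hom_ext
    · rw [coprod.inl_map_assoc, coprod.inl_desc, ← Category.assoc, flatUnit_naturality,
        Category.assoc, (free δ).unit_act, Category.comp_id]
    · rw [coprod.inr_map_assoc, coprod.inr_desc, ← Category.assoc, flatUnit_naturality,
        Category.assoc, (free δ).unit_act, Category.comp_id]
  let η' := freeUnit (can ≫ (free δ).δ)
  have hη' : η' ≫ (free (can ≫ (free δ).δ)).δ = can ≫ (free δ).δ := freeUnit_δ _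
  obtain ⟨f, hf⟩ := exists_freeLift (act ≫ η) hact
  obtain ⟨g, hg⟩ := exists_freeLift can rfl
  obtain ⟨d, hd⟩ := exists_freeLift (A := free (can ≫ (free δ).δ)) (u ≫ η') (f := δ) (by
    rw [Category.assoc, hη', ← Category.assoc, hucan, hη])
  have hdf : d ≫ f = 𝟙 _ := free_hom_ext (by
    rw [comp_hom, ← Category.assoc, hd, Category.assoc, hf, ← Category.assoc, huact,
      Category.id_comp, id_hom, Category.comp_id])
  have hdg : d ≫ g = 𝟙 _ := free_hom_ext (by
    rw [comp_hom, ← Category.assoc, hd, Category.assoc, hg, hucan, id_hom, Category.comp_id])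
  obtain ⟨Q, q, hq, hqe, hqd⟩ := exists_coequalizer f g d.hom (congrArg Hom.hom hdf)
    (congrArg Hom.hom hdg)
  -- A morphism out of the free module respects the relations exactly when its restrictions to `X`
  -- and `Y` are equivariant.
  have coeq_iff : ∀ {Z : PXMod B} (k : free δ ⟶ Z), f ≫ k = g ≫ k ↔
      X.ξ ≫ coprod.inl ≫ η ≫ k.hom = flatMap B (coprod.inl ≫ η ≫ k.hom) ≫ Z.ξ ∧
      Y.ξ ≫ coprod.inr ≫ η ≫ k.hom = flatMap B (coprod.inr ≫ η ≫ k.hom) ≫ Z.ξ := by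
    intro Z k
    have hf' : η' ≫ (f ≫ k).hom = act ≫ η ≫ k.hom := by
      rw [comp_hom, ← Category.assoc, hf, Category.assoc]
    have hg' : η' ≫ (g ≫ k).hom = can ≫ k.hom := by
      rw [comp_hom, ← Category.assoc, hg]
    have e₁ : coprod.inl ≫ can ≫ k.hom = flatMap B (coprod.inl ≫ η ≫ k.hom) ≫ Z.ξ := by
      rw [coprod.inl_desc_assoc, Category.assoc, k.equivariant, ← Category.assoc, ← flatMap_comp,
        Category.assoc]
    have e₂ : coprod.inr ≫ can ≫ k.hom = flatMap B (coprod.inr ≫ η ≫ k.hom) ≫ Z.ξ := by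
      rw [coprod.inr_desc_assoc, Category.assoc, k.equivariant, ← Category.assoc, ← flatMap_comp,
        Category.assoc]
    rw [← e₁, ← e₂, ← coprod.inl_map_assoc X.ξ Y.ξ, ← coprod.inr_map_assoc X.ξ Y.ξ]
    refine ⟨fun h => ?_, fun h => free_hom_ext (hf'.trans (Eq.trans ?_ hg'.symm))⟩
    · have h' : act ≫ η ≫ k.hom = can ≫ k.hom := by rw [← hf', ← hg', h]
      exact ⟨congrArg (fun t => coprod.inl ≫ t) h', congrArg (fun t => coprod.inr ≫ t) h'⟩
    · exact coprod.hom_ext h.1 h.2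
  have hδ : η ≫ q.hom ≫ Q.δ = δ := by rw [q.comm, hη]
  have hq' := (coeq_iff q).1 hq
  let ιX : X ⟶ Q := ⟨coprod.inl ≫ η ≫ q.hom, by
      rw [Category.assoc, Category.assoc, hδ, coprod.inl_desc], hq'.1⟩
  let ιY : Y ⟶ Q := ⟨coprod.inr ≫ η ≫ q.hom, by
      rw [Category.assoc, Category.assoc, hδ, coprod.inr_desc], hq'.2⟩
  have hιX : ∀ {Z : PXMod B} (h : Q ⟶ Z), (ιX ≫ h).hom = coprod.inl ≫ η ≫ q.hom ≫ h.hom := by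
    intro Z h
    change (coprod.inl ≫ η ≫ q.hom) ≫ h.hom = _
    simp only [Category.assoc]
  have hιY : ∀ {Z : PXMod B} (h : Q ⟶ Z), (ιY ≫ h).hom = coprod.inr ≫ η ≫ q.hom ≫ h.hom := by
    intro Z h
    change (coprod.inr ≫ η ≫ q.hom) ≫ h.hom = _
    simp only [Category.assoc]
  have hdesc : ∀ {Z : PXMod B} (a : X ⟶ Z) (b : Y ⟶ Z),
      ∃ h : Q ⟶ Z, ιX ≫ h = a ∧ ιY ≫ h = b := by
    intro Z a b
    obtain ⟨k, hk⟩ := exists_freeLift (f := δ) (coprod.desc a.hom b.hom) (by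
      rw [coprod.desc_comp, a.comm, b.comm])
    have hk' : η ≫ k.hom = coprod.desc a.hom b.hom := hk
    obtain ⟨h, hh⟩ := hqd k ((coeq_iff k).2 (by
      rw [hk', coprod.inl_desc, coprod.inr_desc]
      exact ⟨a.equivariant, b.equivariant⟩))
    have hh' : q.hom ≫ h.hom = k.hom := congrArg Hom.hom hh
    refine ⟨h, hom_ext ?_, hom_ext ?_⟩
    · rw [hιX, hh', hk', coprod.inl_desc]
    · rw [hιY, hh', hk', coprod.inr_desc]
  have huniq : ∀ {Z : PXMod B} (h h' : Q ⟶ Z), ιX ≫ h = ιX ≫ h' → ιY ≫ h = ιY ≫ h' → h = h' := by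
    intro Z h h' hX hY
    apply hom_ext
    rw [← cancel_epi q.hom, ← comp_hom, ← comp_hom]
    refine congrArg Hom.hom (free_hom_ext (coprod.hom_ext ?_ ?_))
    · rw [comp_hom, comp_hom]
      exact (hιX h).symm.trans ((congrArg Hom.hom hX).trans (hιX h'))
    · rw [comp_hom, comp_hom]
      exact (hιY h).symm.trans ((congrArg Hom.hom hY).trans (hιY h'))
  exact ⟨Q, ιX, ιY, hdesc, huniq⟩

end Coproduct

end PXMod

/-! ### Joins of subobjects as images of coproducts. -/

namespace PXMod

variable {C : Type u} [Category.{v} C] [HasZeroMorphisms C] [HasBinaryCoproducts C]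

lemma underlyingSubobject_mono [HasFiniteLimits C] {B : C} {A : PXMod B} {S T : Subobject A}
    (h : S ≤ T) : underlyingSubobject S ≤ underlyingSubobject T :=
  Subobject.mk_le_mk_of_comm (Subobject.ofLE S T h).hom
    (congrArg Hom.hom (Subobject.ofLE_arrow h))

lemma underlyingSubobject_mk [HasFiniteLimits C] {B : C} {I A : PXMod B} (m : I ⟶ A) [Mono m] :
    underlyingSubobject (Subobject.mk m) = Subobject.mk m.hom := by
  apply le_antisymm
  · exact Subobject.mk_le_mk_of_comm (Subobject.underlyingIso m).hom.hom
      (congrArg Hom.hom (Subobject.underlyingIso_hom_comp_eq_mk m))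
  · exact Subobject.mk_le_mk_of_comm (Subobject.underlyingIso m).inv.hom
      (congrArg Hom.hom (Subobject.underlyingIso_arrow m))

/-- The join of two subobjects is the image of the morphism from their coproduct. -/
lemma isLUB_image [Regular C] {B : C} {A P I : PXMod B} {S T : Subobject A}
    {i : (S : PXMod B) ⟶ P} {j : (T : PXMod B) ⟶ P} (hc : IsCoproduct i j) (e : P ⟶ I)
    (he : IsRegularEpi e.hom) (m : I ⟶ A) [Mono m] (h₁ : i ≫ e ≫ m = S.arrow)
    (h₂ : j ≫ e ≫ m = T.arrow) : IsLUB {S, T} (Subobject.mk m) := by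
  constructor
  · rintro K (rfl | rfl)
    · exact Subobject.le_mk_of_comm (i ≫ e) (by rw [Category.assoc, h₁])
    · exact Subobject.le_mk_of_comm (j ≫ e) (by rw [Category.assoc, h₂])
  · intro K hK
    have hS : S ≤ K := hK (by simp)
    have hT : T ≤ K := hK (by simp)
    obtain ⟨k, hk₁, hk₂⟩ := hc.exists_desc (Subobject.ofLE S K hS) (Subobject.ofLE T K hT)
    obtain ⟨l, hl⟩ := exists_lift e he K.arrow k m (hc.hom_ext _ _
      (by rw [← Category.assoc, hk₁, Subobject.ofLE_arrow, h₁])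
      (by rw [← Category.assoc, hk₂, Subobject.ofLE_arrow, h₂]))
    exact Subobject.mk_le_of_comm l hl

/-- The morphism from the coproduct of two subobjects factors through an image. -/
lemma exists_image_coproduct [Regular C] {B : C} {A P : PXMod B} {S T : Subobject A}
    {i : (S : PXMod B) ⟶ P} {j : (T : PXMod B) ⟶ P} (hc : IsCoproduct i j) :
    ∃ (I : PXMod B) (e : P ⟶ I) (m : I ⟶ A), IsRegularEpi e.hom ∧ Mono m ∧
      i ≫ e ≫ m = S.arrow ∧ j ≫ e ≫ m = T.arrow := by
  obtain ⟨f, hf₁, hf₂⟩ := hc.exists_desc S.arrow T.arrow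
  obtain ⟨I, e, m, he, hm, hem⟩ := exists_image f
  exact ⟨I, e, m, he, hm, by rw [hem, hf₁], by rw [hem, hf₂]⟩

end PXMod

/-! ### The equivalence of (CS) and (J). -/

open PXMod

variable {C : Type u} [Category.{v} C] [HasZeroMorphisms C] [HasBinaryCoproducts C] [BarrExact C]

lemma joinsCoincide_of_conditionCS [Protomodular C] (h : ConditionCS C) : JoinsCoincide C := by
  intro B A S T J hJ
  obtain ⟨P, i, j, hc⟩ := exists_isCoproduct (S : PXMod B) (T : PXMod B)
  obtain ⟨I, e, m, he, hm, h₁, h₂⟩ := exists_image_coproduct hc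
  have hlub := isLUB_image hc e he m h₁ h₂
  rw [hJ.unique hlub]
  have hσ : IsRegularEpi (coprod.desc i.hom j.hom) := h B _ _ _ hc.nonempty_isColimit
  have h₁' : i.hom ≫ e.hom ≫ m.hom = S.arrow.hom := congrArg Hom.hom h₁
  have h₂' : j.hom ≫ e.hom ≫ m.hom = T.arrow.hom := congrArg Hom.hom h₂
  constructor
  · rintro K (rfl | rfl)
    · exact underlyingSubobject_mono (hlub.1 (by simp))
    · exact underlyingSubobject_mono (hlub.1 (by simp))
  · intro K hK
    have hS : underlyingSubobject S ≤ K := hK (by simp)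
    have hT : underlyingSubobject T ≤ K := hK (by simp)
    let s := Subobject.ofMkLE S.arrow.hom K hS
    let t := Subobject.ofMkLE T.arrow.hom K hT
    have hs : s ≫ K.arrow = S.arrow.hom := Subobject.ofMkLE_arrow hS
    have ht : t ≫ K.arrow = T.arrow.hom := Subobject.ofMkLE_arrow hT
    -- `σ` followed by `e` is a strong epimorphism, so it lifts against any subobject `K` in `C`
    -- containing both `S` and `T`.
    have sq : CommSq (coprod.desc s t) (coprod.desc i.hom j.hom ≫ e.hom) K.arrow m.hom := ⟨by
      apply coprod.hom_ext
      · rw [coprod.inl_desc_assoc, hs, Category.assoc, coprod.inl_desc_assoc, h₁']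
      · rw [coprod.inr_desc_assoc, ht, Category.assoc, coprod.inr_desc_assoc, h₂']⟩
    have : StrongEpi (coprod.desc i.hom j.hom ≫ e.hom) := strongEpi_comp _ _
    rw [underlyingSubobject_mk]
    exact Subobject.mk_le_of_comm sq.lift sq.fac_right

lemma conditionCS_of_joinsCoincide (h : JoinsCoincide C) : ConditionCS C := by
  intro B X Y c ⟨hcolim⟩
  let P : PXMod B := c.pt
  let i : X ⟶ P := c.inl
  let j : Y ⟶ P := c.inr
  have hc : IsCoproduct i j := isCoproduct_of_isColimit hcolim
  change IsRegularEpi (coprod.desc i.hom j.hom)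
  -- The injections are not assumed monic, so (J) is applied to their images.
  obtain ⟨I₁, e₁, m₁, he₁, hm₁, hem₁⟩ := exists_image i
  obtain ⟨I₂, e₂, m₂, he₂, hm₂, hem₂⟩ := exists_image j
  -- A subobject `K` containing both images receives a morphism from the coproduct, which splits the
  -- inclusion of `K`.
  have hlub : IsLUB {Subobject.mk m₁, Subobject.mk m₂} (⊤ : Subobject P) := by
    refine ⟨fun _ _ => le_top, fun K hK => ?_⟩
    have hS : Subobject.mk m₁ ≤ K := hK (by simp)
    have hT : Subobject.mk m₂ ≤ K := hK (by simp)
    obtain ⟨k, hk₁, hk₂⟩ := hc.exists_desc (e₁ ≫ Subobject.ofMkLE m₁ K hS)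
      (e₂ ≫ Subobject.ofMkLE m₂ K hT)
    have hk : k ≫ K.arrow = 𝟙 _ := hc.hom_ext _ _
      (by rw [← Category.assoc, hk₁, Category.assoc, Subobject.ofMkLE_arrow, hem₁,
        Category.comp_id])
      (by rw [← Category.assoc, hk₂, Category.assoc, Subobject.ofMkLE_arrow, hem₂,
        Category.comp_id])
    exact Subobject.mk_le_of_comm k hk
  obtain ⟨D, p, n, hp, hn, hpn⟩ := exists_regularEpi_mono (coprod.desc i.hom j.hom)
  -- The image `n` of `σ` in `C` contains the images of both injections, by orthogonality of `e₁`
  -- and `e₂` to `n`.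
  have sq₁ : CommSq (coprod.inl ≫ p) e₁.hom n m₁.hom := ⟨by
    rw [Category.assoc, hpn, coprod.inl_desc, ← hem₁, comp_hom]⟩
  have sq₂ : CommSq (coprod.inr ≫ p) e₂.hom n m₂.hom := ⟨by
    rw [Category.assoc, hpn, coprod.inr_desc, ← hem₂, comp_hom]⟩
  have hle : underlyingSubobject (⊤ : Subobject P) ≤ Subobject.mk n := (h B P _ _ _ hlub).2 (by
    rintro K (rfl | rfl)
    · rw [underlyingSubobject_mk]
      exact Subobject.mk_le_mk_of_comm sq₁.lift sq₁.fac_right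
    · rw [underlyingSubobject_mk]
      exact Subobject.mk_le_mk_of_comm sq₂.lift sq₂.fac_right)
  have htop : Subobject.mk (𝟙 P.obj) ≤ Subobject.mk n :=
    (underlyingSubobject_mk (𝟙 P)).symm.trans_le hle
  -- Being above `⊤` gives the mono `n` a section, so it is an isomorphism and `σ` equals `p` up to
  -- it.
  have : IsSplitEpi n := IsSplitEpi.mk' ⟨Subobject.ofMkLEMk _ _ htop, Subobject.ofMkLEMk_comp htop⟩
  have : IsIso n := isIso_of_mono_of_isSplitEpi n
  have : ExtremalEpi (coprod.desc i.hom j.hom) := by rw [← hpn]; infer_instance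
  infer_instance

end SemiAb

theorem mainTheorem5 (C : Type u) [Category.{v} C] [HasZeroMorphisms C] [SemiAb.SemiAbelian C] :
    (∀ B : C, HasBinaryCoproducts (SemiAb.PXMod B)) ∧
    (∀ (B : C) (A : SemiAb.PXMod B) (S T : Subobject A), ∃ J : Subobject A, IsLUB {S, T} J) ∧
    (SemiAb.ConditionCS C ↔ SemiAb.JoinsCoincide C) := by
  refine ⟨fun B => ?_, fun B A S T => ?_,
    SemiAb.joinsCoincide_of_conditionCS, SemiAb.conditionCS_of_joinsCoincide⟩
  · have : ∀ {X Y : SemiAb.PXMod B}, HasColimit (pair X Y) := fun {X Y} => by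
      obtain ⟨P, i, j, hc⟩ := SemiAb.PXMod.exists_isCoproduct X Y
      exact ⟨⟨⟨_, hc.nonempty_isColimit.some⟩⟩⟩
    exact hasBinaryCoproducts_of_hasColimit_pair _
  · obtain ⟨P, i, j, hc⟩ := SemiAb.PXMod.exists_isCoproduct (S : SemiAb.PXMod B) (T : SemiAb.PXMod B)
    obtain ⟨I, e, m, he, hm, h₁, h₂⟩ := SemiAb.PXMod.exists_image_coproduct hc
    exact ⟨_, SemiAb.PXMod.isLUB_image hc e he m h₁ h₂⟩
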